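/- Let $E$ be a finite set. A polymatroid $(E,f)$ is a function $f:2^E\to\mathbb{R}_{\ge 0}$ with $f(\emptyset)=0$ and $f(A)\le f(A\cup B)\le f(A)+f(B)-f(A\cap B)$ for all $A,B\subseteq E$. Its polymatroid polytope is $P_f=\{x\in\mathbb{R}^E : x\ge 0,\ \sum_{a\in A}x_a\le f(A)\text{ for all }A\subseteq E\}$, and its base polytope $B_f$ is the face of $P_f$ consisting of the maximizers over $P_f$ of the linear function $\mathbf{1}(x)=\sum_{e\in E}x_e$. Let $I=\{\mathbf{1}(x):x\in P_f\}\subset\mathbb{R}$. A section of $(P_f,\mathbf{1})$ is a continuous map $\gamma:I\to P_f$ with $\mathbf{1}(\gamma(s))=s$ for all $s\in I$, and the monotone path polytope of $P_f$ with respect to $\mathbf{1}$ is $$\Sigma_{\mathbf{1}}(P_f)=\Bigl\{\,2\int_I\gamma(s)\,ds \ :\ \gamma \text{ a section of }(P_f,\mathbf{1})\Bigr\}\subset\mathbb{R}^E .$$ Theorem. Let $(E,f)$ be a polymatroid and define $\hat f:2^E\to\mathbb{R}$ by $\hat f(A)=2f(E)f(A)-f(A)^2$. Then $(E,\hat f)$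 is a polymatroid, and the monotone path polytope of $P_f$ with respect to $\mathbf{1}$ is its base polytope: $\Sigma_{\mathbf{1}}(P_f)=B_{\hat f}$. -/

import Mathlib

open MeasureTheory

namespace FlagPolymatroid

variable {E : Type*}

/-- A polymatroid `(E, f)`: a monotone submodular function `f : 2^E → ℝ_{≥ 0}` with `f ∅ = 0`,
i.e. `f A ≤ f (A ∪ B) ≤ f A + f B - f (A ∩ B)` for all `A, B ⊆ E`. -/
structure IsPolymatroid [DecidableEq E] (f : Finset E → ℝ) : Prop where
  nonneg : ∀ A : Finset E, 0 ≤ f A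
  empty : f ∅ = 0
  le_union : ∀ A B : Finset E, f A ≤ f (A ∪ B)
  union_le : ∀ A B : Finset E, f (A ∪ B) ≤ f A + f B - f (A ∩ B)

/-- The polymatroid (independence) polytope
`P_f = {x ∈ ℝ^E : x ≥ 0, x(A) ≤ f(A) for all A ⊆ E}`. -/
def polytope (f : Finset E → ℝ) : Set (E → ℝ) :=
  {x | (∀ e : E, 0 ≤ x e) ∧ ∀ A : Finset E, ∑ a ∈ A, x a ≤ f A}

/-- The face `P^w` of `P` in direction `w`: the set of maximizers over `P` of the linear
function `x ↦ ⟨w, x⟩`. -/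
def face [Fintype E] (P : Set (E → ℝ)) (w : E → ℝ) : Set (E → ℝ) :=
  {x | x ∈ P ∧ ∀ y ∈ P, w ⬝ᵥ y ≤ w ⬝ᵥ x}

/-- The base polytope `B_f` of `f`: the face of `P_f` in the all-ones direction. -/
def basePolytope [Fintype E] (f : Finset E → ℝ) : Set (E → ℝ) :=
  face (polytope f) (fun _ => 1)

/-- The image `I = {⟨c, x⟩ : x ∈ P} ⊆ ℝ` of `P` under the linear function `c`. -/
def valueSet [Fintype E] (P : Set (E → ℝ)) (c : E → ℝ) : Set ℝ :=
  (fun x : E → ℝ => c ⬝ᵥ x) '' P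

/-- `γ` restricts to a section of `(P, c)`: a continuous map `I → P` with `⟨c, γ(s)⟩ = s` for
all `s ∈ I`. The values of `γ` outside of `I` play no role. -/
structure IsSection [Fintype E] (P : Set (E → ℝ)) (c : E → ℝ) (γ : ℝ → E → ℝ) : Prop where
  continuousOn : ContinuousOn γ (valueSet P c)
  mem : ∀ s ∈ valueSet P c, γ s ∈ P
  dot_eq : ∀ s ∈ valueSet P c, c ⬝ᵥ γ s = s

/-- The monotone path polytope of `(P, c)`: the set of all `2 ∫_I γ(s) ds`, `γ` a section. -/
noncomputable def monotonePathPolytope [Fintype E] (P : Set (E → ℝ)) (c : E → ℝ) :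
    Set (E → ℝ) :=
  {y | ∃ γ : ℝ → E → ℝ, IsSection P c γ ∧ y = (2 : ℝ) • ∫ s in valueSet P c, γ s}

/-- The underlying flag polymatroid `2 f(E) · f - f²` of `(E, f)`. -/
def flag [Fintype E] (f : Finset E → ℝ) : Finset E → ℝ :=
  fun A => 2 * f Finset.univ * f A - f A ^ 2

end FlagPolymatroid

/-!
The argument rests on the greedy vectors of a polymatroid `g`: for an ordering of `E`, the
coordinate at `e` is the increment of `g` when `e` is added to the set of its predecessors. By
submodularity a greedy vector lies in the polytope of `g`, and its coordinates add up to `g univ`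
(`greedy_mem_polytope`, `sum_greedy`). The base polytope is the convex hull of the greedy vectors
(`basePolytope_subset_convexHull`): a point outside of the hull would be strictly separated from it
by a linear functional `w`, but Abel summation shows that on the base polytope `w` is maximized by
the greedy vector of an ordering along which `w` decreases.

For `s ≥ 0` the truncation `A ↦ min s (f A)` is again a polymatroid, and its base polytope consists
of the points of `P_f` with coordinate sum `s` when `s ≤ f univ`. Everything then follows from
`2 ∫ s in 0..r, min s a = 2 r a - a ^ 2`, where `r = f univ`. Integrating `γ s (A) ≤ min s (f A)`
shows that `2 ∫ γ` belongs to the base polytope of `flag f`. Conversely, for a fixed ordering the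
greedy vectors of the truncations form a section, and twice its integral is the greedy vector of
`flag f`; since the set of sections is convex, the whole base polytope of `flag f` is reached.
-/

namespace FlagPolymatroid

/-! ### Polymatroids obtained from a polymatroid -/

theorem IsPolymatroid.mono {E : Type*} [DecidableEq E] {f : Finset E → ℝ} (hf : IsPolymatroid f)
    {A B : Finset E} (h : A ⊆ B) : f A ≤ f B := by
  simpa [Finset.union_eq_right.mpr h] using hf.le_union A B

theorem IsPolymatroid.truncate {E : Type*} [DecidableEq E] {f : Finset E → ℝ}
    (hf : IsPolymatroid f) {s : ℝ} (hs : 0 ≤ s) : IsPolymatroid fun A => min s (f A) where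
  nonneg A := le_min hs (hf.nonneg A)
  empty := by simpa [hf.empty] using hs
  le_union A B := min_le_min_left s (hf.le_union A B)
  union_le A B := by
    have h := hf.union_le A B
    have hA := hf.mono (Finset.inter_subset_left (s₁ := A) (s₂ := B))
    have hB := hf.mono (Finset.inter_subset_right (s₁ := A) (s₂ := B))
    simp only [min_def]
    split_ifs <;> linarith

theorem IsPolymatroid.flag {E : Type*} [Fintype E] [DecidableEq E] {f : Finset E → ℝ}
    (hf : IsPolymatroid f) : IsPolymatroid (flag f) where
  nonneg A := by
    have h := hf.mono A.subset_univ
    have h0 := hf.nonneg A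
    simp only [FlagPolymatroid.flag]
    nlinarith
  empty := by simp [FlagPolymatroid.flag, hf.empty]
  le_union A B := by
    have h := hf.le_union A B
    have hu := hf.mono (A ∪ B).subset_univ
    simp only [FlagPolymatroid.flag]
    nlinarith
  union_le A B := by
    have h := hf.union_le A B
    have hA := hf.le_union A B
    have hB : f B ≤ f (A ∪ B) := hf.mono Finset.subset_union_right
    have hu := hf.mono (A ∪ B).subset_univ
    have hA' := hf.mono (Finset.inter_subset_left (s₁ := A) (s₂ := B))
    have hB' := hf.mono (Finset.inter_subset_right (s₁ := A) (s₂ := B))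
    simp only [FlagPolymatroid.flag]
    generalize f (A ∪ B) = u at *
    generalize f (A ∩ B) = m at *
    generalize f A = a at *
    generalize f B = b at *
    generalize f Finset.univ = r at *
    -- With `d = a + b - u - m`, the difference of the two sides is
    -- `2 d (r - u) + 2 (a - m) (b - m) - d ^ 2`, where `0 ≤ d ≤ min (a - m) (b - m)`.
    have h1 : 0 ≤ (a + b - u - m) * (r - u) := mul_nonneg (by linarith) (by linarith)
    have h2 : (a + b - u - m) * (a + b - u - m) ≤ (a - m) * (b - m) :=
      mul_le_mul (by linarith) (by linarith) (by linarith) (by linarith)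
    have h3 : 0 ≤ (a - m) * (b - m) := mul_nonneg (by linarith) (by linarith)
    nlinarith

/-! ### Greedy vectors -/

/-- The first `k` elements of `E` in the ordering `τ`. -/
def initialSegment {E : Type*} [Fintype E] {n : ℕ} (τ : E ≃ Fin n) (k : ℕ) : Finset E :=
  Finset.univ.filter fun e => (τ e : ℕ) < k

/-- The greedy vector of `g` for the ordering `τ`: its coordinate at `e` is the increment of `g`
when `e` is added to the set of its predecessors. -/
def greedy {E : Type*} [Fintype E] {n : ℕ} (g : Finset E → ℝ) (τ : E ≃ Fin n) (e : E) : ℝ :=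
  g (initialSegment τ (τ e + 1)) - g (initialSegment τ (τ e))

section

variable {E : Type*} [Fintype E] {n : ℕ} (τ : E ≃ Fin n)

theorem initialSegment_zero : initialSegment τ 0 = ∅ := by
  simp [initialSegment]

theorem initialSegment_card : initialSegment τ n = Finset.univ := by
  simp [initialSegment]

theorem initialSegment_mono {k l : ℕ} (h : k ≤ l) : initialSegment τ k ⊆ initialSegment τ l := by
  intro e
  simp only [initialSegment, Finset.mem_filter, Finset.mem_univ, true_and]
  omega

theorem notMem_initialSegment (e : E) : e ∉ initialSegment τ (τ e) := by
  simp [initialSegment]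

theorem initialSegment_succ [DecidableEq E] (e : E) :
    initialSegment τ (τ e + 1) = insert e (initialSegment τ (τ e)) := by
  ext a
  simp only [initialSegment, Finset.mem_filter, Finset.mem_univ, true_and, Finset.mem_insert,
    Nat.lt_succ_iff_lt_or_eq, Fin.val_inj, τ.injective.eq_iff]
  tauto

variable [DecidableEq E] {g : Finset E → ℝ}

theorem greedy_nonneg (hg : IsPolymatroid g) (e : E) : 0 ≤ greedy g τ e :=
  sub_nonneg.mpr (hg.mono (initialSegment_mono τ (Nat.le_succ _)))

theorem sum_inter_initialSegment_greedy_le (hg : IsPolymatroid g) (A : Finset E) {k : ℕ}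
    (hk : k ≤ n) :
    ∑ e ∈ A ∩ initialSegment τ k, greedy g τ e ≤ g (A ∩ initialSegment τ k) := by
  induction k with
  | zero => simp [initialSegment_zero, hg.empty]
  | succ k ih =>
    obtain ⟨e, he⟩ := τ.surjective ⟨k, hk⟩
    have hek : (τ e : ℕ) = k := by simp [he]
    subst hek
    have ih := ih (by omega)
    have hn := notMem_initialSegment τ e
    by_cases heA : e ∈ A
    · have hle := hg.union_le (A ∩ initialSegment τ (τ e + 1)) (initialSegment τ (τ e))
      have hun : A ∩ initialSegment τ (τ e + 1) ∪ initialSegment τ (τ e) =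
          initialSegment τ (τ e + 1) := by
        rw [initialSegment_succ]
        ext a
        simp only [Finset.mem_union, Finset.mem_inter, Finset.mem_insert]
        grind
      have hin : A ∩ initialSegment τ (τ e + 1) ∩ initialSegment τ (τ e) =
          A ∩ initialSegment τ (τ e) := by
        rw [Finset.inter_assoc,
          Finset.inter_eq_right.mpr (initialSegment_mono τ (Nat.le_succ _))]
      rw [hun, hin] at hle
      have hs : A ∩ initialSegment τ (τ e + 1) = insert e (A ∩ initialSegment τ (τ e)) := by
        rw [initialSegment_succ, Finset.inter_insert_of_mem heA]
      have hsum : ∑ a ∈ A ∩ initialSegment τ (τ e + 1), greedy g τ a =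
          greedy g τ e + ∑ a ∈ A ∩ initialSegment τ (τ e), greedy g τ a := by
        rw [hs, Finset.sum_insert (by simp [hn])]
      rw [hsum]
      simp only [greedy] at ih ⊢
      linarith
    · rw [initialSegment_succ, Finset.inter_insert_of_notMem heA]
      exact ih

theorem greedy_mem_polytope (hg : IsPolymatroid g) : greedy g τ ∈ polytope g := by
  refine ⟨greedy_nonneg τ hg, fun A => ?_⟩
  simpa [initialSegment_card] using sum_inter_initialSegment_greedy_le τ hg A le_rfl

theorem sum_greedy (hg : IsPolymatroid g) : ∑ e, greedy g τ e = g Finset.univ := by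
  rw [← τ.symm.sum_comp]
  simp only [greedy, Equiv.apply_symm_apply]
  rw [Fin.sum_univ_eq_sum_range
    (fun i => g (initialSegment τ (i + 1)) - g (initialSegment τ i)),
    Finset.sum_range_sub (fun i => g (initialSegment τ i)), initialSegment_card,
    initialSegment_zero, hg.empty, sub_zero]

end

/-! ### The base polytope -/

/-- Abel summation: a decreasing weight, summed against the increments of a nonnegative sequence
starting at zero, is at least what its last value contributes. -/
theorem antitone_mul_le_sum_mul_sub {D : ℕ → ℝ} (h0 : D 0 = 0) (hD : ∀ k, 0 ≤ D k) (n : ℕ)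
    {w : Fin (n + 1) → ℝ} (hw : Antitone w) :
    w (Fin.last n) * D (n + 1) ≤ ∑ i : Fin (n + 1), w i * (D (i + 1) - D i) := by
  induction n with
  | zero => simp [h0]
  | succ n ih =>
    rw [Fin.sum_univ_castSucc]
    have h := ih (w := fun i => w i.castSucc) fun i j hij => hw (by simpa using hij)
    have hlast : w (Fin.last (n + 1)) ≤ w (Fin.last n).castSucc := hw (Fin.le_last _)
    have := mul_le_mul_of_nonneg_right hlast (hD (n + 1))
    simp only [Fin.val_castSucc, Fin.val_last] at h ⊢
    linarith

theorem exists_equiv_antitone {E : Type*} [Fintype E] (w : E → ℝ) :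
    ∃ τ : E ≃ Fin (Fintype.card E), Antitone (w ∘ τ.symm) := by
  let e₀ := Fintype.equivFin E
  let v : Fin (Fintype.card E) → ℝ := fun i => -w (e₀.symm i)
  refine ⟨e₀.trans (Tuple.sort v).symm, fun i j hij => ?_⟩
  have := Tuple.monotone_sort v hij
  simpa [v] using this

section

variable {E : Type*} [Fintype E] [DecidableEq E] {g : Finset E → ℝ}

theorem mem_basePolytope_iff (hg : IsPolymatroid g) {x : E → ℝ} :
    x ∈ basePolytope g ↔ x ∈ polytope g ∧ ∑ e, x e = g Finset.univ := by
  have hdot : ∀ y : E → ℝ, (fun _ : E => (1 : ℝ)) ⬝ᵥ y = ∑ e, y e := fun y => by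
    simp [dotProduct]
  simp only [basePolytope, face, Set.mem_ofPred_eq, hdot]
  refine and_congr_right fun hx => ⟨fun h => le_antisymm (hx.2 _) ?_, fun h y hy => ?_⟩
  · rw [← sum_greedy (Fintype.equivFin E) hg]
    exact h _ (greedy_mem_polytope _ hg)
  · exact h ▸ hy.2 _

/-- The greedy vector maximizes every weight that decreases along its ordering. -/
theorem sum_mul_le_sum_mul_greedy (hg : IsPolymatroid g) {y : E → ℝ} (hy : y ∈ basePolytope g)
    {w : E → ℝ} {n : ℕ} (τ : E ≃ Fin n) (hw : Antitone (w ∘ τ.symm)) :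
    ∑ e, w e * y e ≤ ∑ e, w e * greedy g τ e := by
  obtain ⟨hyP, hyE⟩ := (mem_basePolytope_iff hg).mp hy
  let D : ℕ → ℝ := fun k => g (initialSegment τ k) - ∑ e ∈ initialSegment τ k, y e
  have h0 : D 0 = 0 := by simp [D, initialSegment_zero, hg.empty]
  have hD : ∀ k, 0 ≤ D k := fun k => sub_nonneg.mpr (hyP.2 _)
  have hn : D n = 0 := by simp [D, initialSegment_card, hyE]
  have key : ∑ e, w e * greedy g τ e - ∑ e, w e * y e =
      ∑ i : Fin n, (w ∘ τ.symm) i * (D (i + 1) - D i) := by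
    rw [← Finset.sum_sub_distrib, ← τ.sum_comp]
    refine Finset.sum_congr rfl fun e _ => ?_
    have : ∑ a ∈ initialSegment τ (τ e + 1), y a = y e + ∑ a ∈ initialSegment τ (τ e), y a := by
      rw [initialSegment_succ, Finset.sum_insert (notMem_initialSegment τ e)]
    simp only [D, greedy, this, Function.comp, Equiv.symm_apply_apply]
    ring
  have hpos : 0 ≤ ∑ i : Fin n, (w ∘ τ.symm) i * (D (i + 1) - D i) := by
    cases n with
    | zero => simp
    | succ n => simpa [hn] using antitone_mul_le_sum_mul_sub h0 hD n hw
  linarith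

theorem basePolytope_subset_convexHull (hg : IsPolymatroid g) :
    basePolytope g ⊆ convexHull ℝ (Set.range (greedy g (n := Fintype.card E))) := by
  intro y hy
  by_contra hnot
  obtain ⟨φ, c, hlt, hc⟩ := geometric_hahn_banach_closed_point (convex_convexHull ℝ _)
    ((Set.finite_range (greedy g (n := Fintype.card E))).isClosed_convexHull ℝ) hnot
  have hφ : ∀ x : E → ℝ, φ x = ∑ e, φ (Pi.single e 1) * x e := fun x => by
    have hx : x = ∑ e, x e • (Pi.single e (1 : ℝ) : E → ℝ) := by
      simpa using (pi_eq_sum_univ' x)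
    conv_lhs => rw [hx]
    simp [mul_comm]
  obtain ⟨τ, hτ⟩ := exists_equiv_antitone fun e => φ (Pi.single e 1)
  have h1 := hlt _ (subset_convexHull ℝ _ ⟨τ, rfl⟩)
  have h2 := sum_mul_le_sum_mul_greedy hg hy τ hτ
  rw [← hφ, ← hφ] at h2
  linarith

end

/-! ### Sections and their integrals -/

theorem two_mul_setIntegral_min {a r : ℝ} (ha : 0 ≤ a) (har : a ≤ r) :
    2 * ∫ s in Set.Icc 0 r, min s a = 2 * r * a - a ^ 2 := by
  have hcont : Continuous fun s : ℝ => min s a := by fun_prop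
  rw [integral_Icc_eq_integral_Ioc, ← intervalIntegral.integral_of_le (ha.trans har),
    ← intervalIntegral.integral_add_adjacent_intervals (hcont.intervalIntegrable 0 a)
      (hcont.intervalIntegrable a r)]
  have h1 : ∫ s in (0 : ℝ)..a, min s a = ∫ s in (0 : ℝ)..a, s :=
    intervalIntegral.integral_congr fun s hs => by
      rw [Set.uIcc_of_le ha] at hs
      exact min_eq_left hs.2
  have h2 : ∫ s in a..r, min s a = ∫ _ in a..r, a :=
    intervalIntegral.integral_congr fun s hs => by
      rw [Set.uIcc_of_le har] at hs
      exact min_eq_right hs.1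
  rw [h1, h2, integral_id, intervalIntegral.integral_const, smul_eq_mul]
  ring

theorem polytope_convex {E : Type*} (f : Finset E → ℝ) : Convex ℝ (polytope f) := by
  intro x hx y hy a b ha hb hab
  refine ⟨fun e => ?_, fun A => ?_⟩
  · have h1 := mul_nonneg ha (hx.1 e)
    have h2 := mul_nonneg hb (hy.1 e)
    simpa using add_nonneg h1 h2
  · have h1 := mul_le_mul_of_nonneg_left (hx.2 A) ha
    have h2 := mul_le_mul_of_nonneg_left (hy.2 A) hb
    have h3 : a * f A + b * f A = f A := by rw [← add_mul, hab, one_mul]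
    simp only [Pi.add_apply, Pi.smul_apply, smul_eq_mul, Finset.sum_add_distrib,
      ← Finset.mul_sum]
    linarith

section

variable {E : Type*} [Fintype E]

theorem monotonePathPolytope_convex {P : Set (E → ℝ)} (hP : Convex ℝ P) {c : E → ℝ}
    (hI : IsCompact (valueSet P c)) : Convex ℝ (monotonePathPolytope P c) := by
  rintro _ ⟨γ, hγ, rfl⟩ _ ⟨δ, hδ, rfl⟩ a b ha hb hab
  refine ⟨fun s => a • γ s + b • δ s, ⟨?_, fun s hs => ?_, fun s hs => ?_⟩, ?_⟩
  · exact (hγ.continuousOn.const_smul a).add (hδ.continuousOn.const_smul b)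
  · exact hP (hγ.mem s hs) (hδ.mem s hs) ha hb hab
  · rw [dotProduct_add, dotProduct_smul, dotProduct_smul, hγ.dot_eq s hs, hδ.dot_eq s hs,
      ← add_smul, hab, one_smul]
  · have hγi := hγ.continuousOn.integrableOn_compact (μ := volume) hI
    have hδi := hδ.continuousOn.integrableOn_compact (μ := volume) hI
    have hadd := integral_add (hγi.smul a) (hδi.smul b)
    simp only [Pi.smul_apply] at hadd
    beta_reduce
    rw [hadd, integral_smul, integral_smul, smul_add,
      smul_comm a, smul_comm b]

variable [DecidableEq E] {f : Finset E → ℝ}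

/-- For a fixed ordering, the greedy vector of the truncation of `f` at `s` lies in `P_f` on the
slice of coordinate sum `s`. -/
theorem greedy_truncate_mem (hf : IsPolymatroid f) {n : ℕ} (τ : E ≃ Fin n) {s : ℝ}
    (hs : s ∈ Set.Icc 0 (f Finset.univ)) :
    greedy (fun A => min s (f A)) τ ∈ polytope f ∧
      (fun _ : E => (1 : ℝ)) ⬝ᵥ greedy (fun A => min s (f A)) τ = s := by
  have h := greedy_mem_polytope τ (hf.truncate hs.1)
  refine ⟨⟨h.1, fun A => (h.2 A).trans (min_le_right _ _)⟩, ?_⟩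
  simp only [dotProduct, one_mul]
  rw [sum_greedy τ (hf.truncate hs.1), min_eq_left hs.2]

theorem valueSet_polytope (hf : IsPolymatroid f) :
    valueSet (polytope f) (fun _ : E => (1 : ℝ)) = Set.Icc 0 (f Finset.univ) := by
  ext s
  constructor
  · rintro ⟨x, hx, rfl⟩
    simp only [dotProduct, one_mul]
    exact ⟨Finset.sum_nonneg fun e _ => hx.1 e, hx.2 _⟩
  · intro hs
    exact ⟨_, greedy_truncate_mem hf (Fintype.equivFin E) hs⟩

theorem greedy_flag_mem_monotonePathPolytope (hf : IsPolymatroid f) {n : ℕ} (τ : E ≃ Fin n) :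
    greedy (flag f) τ ∈ monotonePathPolytope (polytope f) (fun _ : E => (1 : ℝ)) := by
  have hcont : Continuous fun s : ℝ => greedy (fun A => min s (f A)) τ := by
    unfold greedy
    fun_prop
  refine ⟨fun s => greedy (fun A => min s (f A)) τ, ?_, ?_⟩
  · constructor
    · exact hcont.continuousOn
    · exact fun s hs => (greedy_truncate_mem hf τ (valueSet_polytope hf ▸ hs)).1
    · exact fun s hs => (greedy_truncate_mem hf τ (valueSet_polytope hf ▸ hs)).2
  · rw [valueSet_polytope hf]
    ext e
    have hint : ∀ a : ℝ, IntegrableOn (fun s : ℝ => min s a) (Set.Icc 0 (f Finset.univ)) :=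
      fun a => Continuous.integrableOn_Icc (by fun_prop)
    have hmin : ∀ A, 2 * ∫ s in Set.Icc 0 (f Finset.univ), min s (f A) = flag f A := fun A =>
      two_mul_setIntegral_min (hf.nonneg A) (hf.mono A.subset_univ)
    rw [Pi.smul_apply, eval_integral fun e => ?_]
    · simp only [greedy]
      rw [integral_sub (hint _) (hint _), smul_eq_mul, mul_sub, hmin, hmin]
    · exact (hint _).sub (hint _)

theorem monotonePathPolytope_subset_basePolytope_flag (hf : IsPolymatroid f) :
    monotonePathPolytope (polytope f) (fun _ : E => (1 : ℝ)) ⊆ basePolytope (flag f) := by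
  rintro _ ⟨γ, hγ, rfl⟩
  have hcont := hγ.continuousOn
  have hmem := hγ.mem
  have hdot := hγ.dot_eq
  rw [valueSet_polytope hf] at hcont hmem hdot ⊢
  have hint : ∀ e, IntegrableOn (fun s => γ s e) (Set.Icc 0 (f Finset.univ)) := fun e =>
    ((continuous_apply e).comp_continuousOn hcont).integrableOn_Icc
  have hsum : ∀ A : Finset E, ∑ a ∈ A, ((2 : ℝ) • ∫ s in Set.Icc 0 (f Finset.univ), γ s) a =
      2 * ∫ s in Set.Icc 0 (f Finset.univ), ∑ a ∈ A, γ s a := fun A => by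
    rw [integral_finsetSum _ fun a _ => hint a, Finset.mul_sum]
    refine Finset.sum_congr rfl fun a _ => ?_
    rw [Pi.smul_apply, eval_integral hint, smul_eq_mul]
  have htot : ∀ s ∈ Set.Icc 0 (f Finset.univ), ∑ e, γ s e = s := fun s hs => by
    simpa [dotProduct] using hdot s hs
  have hmin : ∀ A, 2 * ∫ s in Set.Icc 0 (f Finset.univ), min s (f A) = flag f A := fun A =>
    two_mul_setIntegral_min (hf.nonneg A) (hf.mono A.subset_univ)
  refine (mem_basePolytope_iff hf.flag).mpr ⟨⟨fun e => ?_, fun A => ?_⟩, ?_⟩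
  · rw [Pi.smul_apply, eval_integral hint]
    exact mul_nonneg zero_le_two
      (setIntegral_nonneg measurableSet_Icc fun s hs => (hmem s hs).1 e)
  · rw [hsum, ← hmin]
    refine mul_le_mul_of_nonneg_left (setIntegral_mono_on
      (integrable_finsetSum _ fun a _ => hint a) (Continuous.integrableOn_Icc (by fun_prop))
      measurableSet_Icc fun s hs => le_min ?_ ((hmem s hs).2 A)) zero_le_two
    calc ∑ a ∈ A, γ s a ≤ ∑ e, γ s e :=
          Finset.sum_le_sum_of_subset_of_nonneg A.subset_univ fun e _ _ => (hmem s hs).1 e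
      _ = s := htot s hs
  · rw [hsum, ← hmin]
    congr 1
    refine setIntegral_congr_fun measurableSet_Icc fun s hs => ?_
    simp only [htot s hs, min_eq_left hs.2]

end

end FlagPolymatroid

theorem theorem3p7 {E : Type*} [Fintype E] [DecidableEq E] (f : Finset E → ℝ)
    (hf : FlagPolymatroid.IsPolymatroid f) :
    FlagPolymatroid.IsPolymatroid (FlagPolymatroid.flag f) ∧
      FlagPolymatroid.monotonePathPolytope (FlagPolymatroid.polytope f) (fun _ : E => (1 : ℝ)) =
        FlagPolymatroid.basePolytope (FlagPolymatroid.flag f) := by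
  refine ⟨hf.flag, (FlagPolymatroid.monotonePathPolytope_subset_basePolytope_flag hf).antisymm ?_⟩
  refine (FlagPolymatroid.basePolytope_subset_convexHull hf.flag).trans (convexHull_min ?_ ?_)
  · rintro _ ⟨τ, rfl⟩
    exact FlagPolymatroid.greedy_flag_mem_monotonePathPolytope hf τ
  · refine FlagPolymatroid.monotonePathPolytope_convex (FlagPolymatroid.polytope_convex f) ?_
    rw [FlagPolymatroid.valueSet_polytope hf]
    exact isCompact_Icc
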